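/- For $r\ge 0$ let $S_r=\mathbf C[z_0,\dots,z_r]$. For a finitely generated graded $S_r$-module $M$ with minimal graded free resolution $E_\bullet$, let $k_{p,q}(M)$ be the number of minimal generators of $E_p$ of degree $p+q$. Fix $i_0\in\{0,1\}$, and for every $r$ and every $i_0\le i\le r$ let $\Pi_{r,i}$ be a pure module of type $(r,i)$, i.e. a finitely generated graded $S_r$-module of dimension one (so its Hilbert function is eventually equal to a positive constant, its multiplicity $e(\Pi_{r,i})$) such that \[k_{p,1}(\Pi_{r,i})\ne0\iff 0\le p<i,\qquad k_{p,2}(\Pi_{r,i})\neq 0\iff i\le p\le r,\qquad k_{p,q}(\Pi_{r,i})=0\ \text{ for } q\ne1,2 .\] Since the tables of the $\Pi_{r,i}$ are determined only up to scaling, assume they are normalized so that, for each $r$, the multiplicities $e(\Pi_{r,i})$, $i_0\le i\le r$, are equal, or more generally so that there is a constant $C$ with $e(\Pi_{r,i})\le C\,e(\Pi_{r,j})$ for all $r,i,j$. Let $\Omega_r$ be the cube of all $x=(x_i)_{i_0\le i\le r}$ with $x_i\in[0,1]$ (so $\Omega_r=[0,1]^r$ if $i_0=1$), and for $x\in\Omega_r$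 put \[k_{p,q}(x)=\sum_{i=i_0}^{r}x_i\,k_{p,q}(\Pi_{r,i}).\] **Theorem.** Fix $q=1$ or $q=2$. There is a (deterministic) normalizing function $F_q(r)$ with the following property. Let $x_0,x_1,x_2,\dots$ be random variables on a common probability space, with an arbitrary joint distribution (for instance independent), such that each $x_r$ is uniformly distributed in $\Omega_r$. Then with probability $1$ the following holds: for every $a\in\mathbf R$ and every sequence $(p_r)$ of non-negative integers with $\lim_{r\to\infty}\frac{2p_r-r}{\sqrt r}=a$, \[F_q(r)\cdot k_{p_r,q}(x_r)\longrightarrow e^{-a^2/2}\qquad\text{as } r\to\infty .\] -/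

import Mathlib

open MeasureTheory Filter Topology

/-- A minimal graded free resolution
`⋯ → E 2 → E 1 → E 0`, `E p = ⨁ j, S(-deg p j)`, over `S = ℂ[x_0, …, x_{n-1}]`.
The matrix `d p` is the differential `E (p+1) → E p` in the given bases. Its nonzero entries are
homogeneous of degree `deg (p+1) k - deg p j` (so that the differential preserves degrees), and this
degree is positive (minimality). Such a resolution presents the finitely generated graded
`S`-module `coker (d 0)`, and every finitely generated graded `S`-module arises in this way. -/
structure MinGradedResolution (n : ℕ) where
  rank : ℕ → ℕ
  deg : (p : ℕ) → Fin (rank p) → ℤ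
  d : (p : ℕ) → Matrix (Fin (rank p)) (Fin (rank (p + 1))) (MvPolynomial (Fin n) ℂ)
  deg_lt : ∀ p j k, d p j k ≠ 0 → deg p j < deg (p + 1) k
  homogeneous : ∀ p j k, d p j k ≠ 0 →
    (d p j k).IsHomogeneous (deg (p + 1) k - deg p j).toNat
  exact : ∀ p, LinearMap.range (d (p + 1)).mulVecLin = LinearMap.ker (d p).mulVecLin

namespace MinGradedResolution

variable {n : ℕ}

/-- The module that is resolved. -/
abbrev Coker (M : MinGradedResolution n) : Type :=
  (Fin (M.rank 0) → MvPolynomial (Fin n) ℂ) ⧸ LinearMap.range (M.d 0).mulVecLin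

/-- The Betti number `k_{p,q}`: the number of generators of `E p` of degree `p + q`, that is, the
dimension of the syzygy space `K_{p,q}` of the resolved module. -/
def betti (M : MinGradedResolution n) (p : ℕ) (q : ℤ) : ℕ :=
  (Finset.univ.filter fun j : Fin (M.rank p) => M.deg p j = p + q).card

/-- The degree `m` part of the free module `E 0`. -/
noncomputable def freeDegreePart (M : MinGradedResolution n) (m : ℤ) :
    Submodule ℂ (Fin (M.rank 0) → MvPolynomial (Fin n) ℂ) :=
  Submodule.pi Set.univ fun j =>
    if M.deg 0 j ≤ m then MvPolynomial.homogeneousSubmodule (Fin n) ℂ (m - M.deg 0 j).toNat else ⊥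

/-- The Hilbert function of the resolved module: the dimension of its degree `m` part, which is the
image of the degree `m` part of `E 0`. -/
noncomputable def hilbertFunction (M : MinGradedResolution n) (m : ℤ) : ℕ :=
  Module.finrank ℂ ((M.freeDegreePart m).map
    ((LinearMap.range (M.d 0).mulVecLin).mkQ.restrictScalars ℂ))

/-- The resolved module is one-dimensional of multiplicity `e`: its Hilbert polynomial is the
positive constant `e`. -/
def IsOneDimOfMultiplicity (M : MinGradedResolution n) (e : ℕ) : Prop :=
  0 < e ∧ ∀ᶠ m : ℤ in atTop, M.hilbertFunction m = e

/-- The Betti table has the shape of the pure module `Π_i`: its first row (`q = 1`) is nonzero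
exactly for `0 ≤ p < i`, its second row (`q = 2`) exactly for `i ≤ p ≤ r`, and all other rows
vanish. -/
def HasPureShape (M : MinGradedResolution n) (r i : ℕ) : Prop :=
  ∀ (p : ℕ) (q : ℤ), M.betti p q ≠ 0 ↔ (q = 1 ∧ p < i) ∨ (q = 2 ∧ i ≤ p ∧ p ≤ r)

end MinGradedResolution

/-- The entry `k_{p,q}(x) = ∑ i, x_i * k_{p,q}(Π_i)` of the Betti table with Boij–Söderberg
coefficients `x`. -/
def tableEntry {n : ℕ} {ι : Type*} [Fintype ι] (Pi : ι → MinGradedResolution n)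
    (x : ι → ℝ) (p : ℕ) (q : ℤ) : ℝ :=
  ∑ i, x i * ((Pi i).betti p q : ℝ)

/-! The Betti numbers of a pure module are explicit. Exactness in each degree makes the Hilbert
function an alternating sum of binomial coefficients. Its eventual constancy `e` determines all
ranks (Herzog–Kühl), and the shifts are, up to adding 1, the integers `0, …, r+1` except `i`, so
that `k_{p,1} = C(r+1,p)/(r+1) · e · (i-p)⁺` and `k_{p,2} = C(r+1,p+1)/(r+1) · e · (p+1-i)⁺`.

Hence `k_{p,q}(x)` is a binomial coefficient times a weighted sum of the `x_i`. By Stirling, the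
binomial coefficient produces the Gaussian. The other factor is asymptotically deterministic. Moving
the truncation point from `p` (or `p+1`) to `r/2` costs `O(r^{3/2})`, while after normalizing `e`
the mean is at least a constant times `r²`. By Hoeffding, a fluctuation of size `ε r²` has
probability exponentially small in `r`.

Borel–Cantelli needs only summability of these probabilities, so the joint distribution of the rows
is irrelevant. The exceptional null set concerns the sums centred at `r/2`, so it serves all `a` and
all sequences `p` at once. -/

/-! ### Graded pieces of a resolution and the Hilbert function -/

theorem Submodule.finrank_map_add_finrank_inf_ker {K V W : Type*} [Field K] [AddCommGroup V]
    [Module K V] [AddCommGroup W] [Module K W] (f : V →ₗ[K] W) (D : Submodule K V)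
    [FiniteDimensional K D] :
    Module.finrank K (D.map f) + Module.finrank K (D ⊓ LinearMap.ker f : Submodule K V) =
      Module.finrank K D := by
  rw [← LinearMap.finrank_range_add_finrank_ker (f.domRestrict D), LinearMap.range_domRestrict,
    LinearMap.ker_domRestrict]
  congr 1
  have h : (D ⊓ LinearMap.ker f) = ((LinearMap.ker f).comap D.subtype).map D.subtype := by
    rw [Submodule.map_comap_subtype]
  rw [h]
  exact Submodule.finrank_map_subtype_eq D _

namespace MvPolynomial

variable {σ : Type*}

/-- The degree `k` part of a polynomial ring, zero for negative `k`. -/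
noncomputable def intHomogeneousSubmodule (σ : Type*) (k : ℤ) : Submodule ℂ (MvPolynomial σ ℂ) :=
  if 0 ≤ k then homogeneousSubmodule σ ℂ k.toNat else ⊥

/-- The projection to the degree `k` part of a polynomial ring, zero for negative `k`. -/
noncomputable def intHomogeneousComponent (k : ℤ) : MvPolynomial σ ℂ →ₗ[ℂ] MvPolynomial σ ℂ :=
  if 0 ≤ k then homogeneousComponent k.toNat else 0

theorem intHomogeneousComponent_mem (k : ℤ) (φ : MvPolynomial σ ℂ) :
    intHomogeneousComponent k φ ∈ intHomogeneousSubmodule σ k := by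
  unfold intHomogeneousComponent intHomogeneousSubmodule
  split_ifs
  · exact homogeneousComponent_mem _ _
  · simp

theorem intHomogeneousComponent_of_mem {k : ℤ} {φ : MvPolynomial σ ℂ}
    (h : φ ∈ intHomogeneousSubmodule σ k) : intHomogeneousComponent k φ = φ := by
  unfold intHomogeneousSubmodule at h
  unfold intHomogeneousComponent
  split_ifs at h ⊢
  · exact homogeneousComponent_eq_self h
  · simpa using h.symm

theorem homogeneousComponent_mul_of_isHomogeneous {s : ℕ} {a : MvPolynomial σ ℂ}
    (ha : a.IsHomogeneous s) (w : MvPolynomial σ ℂ) (k : ℕ) :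
    homogeneousComponent k (a * w) = if s ≤ k then a * homogeneousComponent (k - s) w else 0 := by
  let _ : GradedAlgebra (homogeneousSubmodule σ ℂ) := gradedAlgebra
  have h (φ : MvPolynomial σ ℂ) (i : ℕ) :
      (DirectSum.decompose (homogeneousSubmodule σ ℂ) φ i : MvPolynomial σ ℂ) =
        homogeneousComponent i φ := decomposition.decompose'_apply φ i
  rw [← h, ← h]
  exact DirectSum.coe_decompose_mul_of_left_mem (homogeneousSubmodule σ ℂ) k ha

/-- Indexing by integers makes this uniform: for `k < 0` the left side vanishes too, since a
multiple of `a` has no component below degree `s`. -/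
theorem intHomogeneousComponent_mul {s : ℕ} {a : MvPolynomial σ ℂ} (ha : a.IsHomogeneous s)
    (w : MvPolynomial σ ℂ) (k : ℤ) :
    intHomogeneousComponent (k + s) (a * w) = a * intHomogeneousComponent k w := by
  unfold intHomogeneousComponent
  by_cases h : 0 ≤ k
  · lift k to ℕ using h
    have h1 : (0 : ℤ) ≤ (k : ℤ) + s := by positivity
    have h2 : ((k : ℤ) + s).toNat = k + s := by omega
    rw [if_pos h1, h2, if_pos (by positivity), homogeneousComponent_mul_of_isHomogeneous ha]
    simp
  · rw [if_neg h]
    split_ifs with h1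
    · rw [homogeneousComponent_mul_of_isHomogeneous ha, if_neg (by omega)]
      simp
    · simp

end MvPolynomial

namespace MinGradedResolution

open MvPolynomial

variable {n : ℕ} (M : MinGradedResolution n)

/-- The degree `m` part of the free module `E p`. -/
noncomputable def degreePart (p : ℕ) (m : ℤ) :
    Submodule ℂ (Fin (M.rank p) → MvPolynomial (Fin n) ℂ) :=
  Submodule.pi Set.univ fun j => intHomogeneousSubmodule (Fin n) (m - M.deg p j)

theorem freeDegreePart_eq (m : ℤ) : M.freeDegreePart m = M.degreePart 0 m := by
  simp [freeDegreePart, degreePart, intHomogeneousSubmodule]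

/-- The projection to the degree `m` part of `E p`. -/
noncomputable def degreeComponent (p : ℕ) (m : ℤ) (v : Fin (M.rank p) → MvPolynomial (Fin n) ℂ) :
    Fin (M.rank p) → MvPolynomial (Fin n) ℂ :=
  fun j => intHomogeneousComponent (m - M.deg p j) (v j)

theorem degreeComponent_mem (p : ℕ) (m : ℤ) (v : Fin (M.rank p) → MvPolynomial (Fin n) ℂ) :
    M.degreeComponent p m v ∈ M.degreePart p m :=
  fun _ _ => intHomogeneousComponent_mem _ _

theorem degreeComponent_of_mem {p : ℕ} {m : ℤ} {v : Fin (M.rank p) → MvPolynomial (Fin n) ℂ}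
    (h : v ∈ M.degreePart p m) : M.degreeComponent p m v = v :=
  funext fun j => intHomogeneousComponent_of_mem (h j trivial)

theorem degreeComponent_mulVec (p : ℕ) (m : ℤ)
    (w : Fin (M.rank (p + 1)) → MvPolynomial (Fin n) ℂ) :
    M.degreeComponent p m ((M.d p).mulVec w) =
      (M.d p).mulVec (M.degreeComponent (p + 1) m w) := by
  ext1 j
  simp only [degreeComponent, Matrix.mulVec, dotProduct, map_sum]
  refine Finset.sum_congr rfl fun k _ => ?_
  by_cases h : M.d p j k = 0
  · simp [h]
  -- Minimality makes the degree difference positive, so the `toNat` in `homogeneous` loses nothing.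
  · have h1 := M.deg_lt p j k h
    rw [← intHomogeneousComponent_mul (M.homogeneous p j k h)]
    congr 2
    omega

/-- The differential as a `ℂ`-linear map. -/
noncomputable def differential (p : ℕ) : (Fin (M.rank (p + 1)) → MvPolynomial (Fin n) ℂ) →ₗ[ℂ]
    (Fin (M.rank p) → MvPolynomial (Fin n) ℂ) :=
  (M.d p).mulVecLin.restrictScalars ℂ

theorem differential_apply (p : ℕ) (w : Fin (M.rank (p + 1)) → MvPolynomial (Fin n) ℂ) :
    M.differential p w = (M.d p).mulVec w := rfl

/-- An element of degree `m` in the image has a preimage of degree `m`: project any preimage to its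
degree `m` part, which commutes with the differential. This lets exactness be used degree by degree.
-/
theorem map_degreePart (p : ℕ) (m : ℤ) :
    (M.degreePart (p + 1) m).map (M.differential p) =
      M.degreePart p m ⊓ LinearMap.range (M.differential p) := by
  ext v
  constructor
  · rintro ⟨w, hw, rfl⟩
    refine ⟨?_, w, rfl⟩
    have h := M.degreeComponent_mulVec p m w
    rw [M.degreeComponent_of_mem hw] at h
    rw [differential_apply, ← h]
    exact M.degreeComponent_mem _ _ _
  · rintro ⟨hv, w, rfl⟩
    refine ⟨M.degreeComponent (p + 1) m w, M.degreeComponent_mem _ _ _, ?_⟩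
    have h := M.degreeComponent_mulVec p m w
    rw [differential_apply, ← h]
    exact M.degreeComponent_of_mem hv

theorem range_differential (p : ℕ) :
    LinearMap.range (M.differential (p + 1)) = LinearMap.ker (M.differential p) := by
  ext v
  have h := SetLike.ext_iff.1 (M.exact p) v
  simpa [differential] using h

instance (k : ℤ) : FiniteDimensional ℂ (intHomogeneousSubmodule (Fin n) k) := by
  refine Module.Finite.iff_fg.2 ?_
  rw [intHomogeneousSubmodule]
  split_ifs
  · exact homogeneousSubmodule_fg _ _ _
  · exact Submodule.fg_bot

/-- The degree `m` part of `E p` as the product of graded parts of the polynomial ring. -/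
noncomputable def degreePartEquiv (p : ℕ) (m : ℤ) : M.degreePart p m ≃ₗ[ℂ]
    ((j : Fin (M.rank p)) → intHomogeneousSubmodule (Fin n) (m - M.deg p j)) where
  toFun v j := ⟨v.1 j, v.2 j trivial⟩
  invFun v := ⟨fun j => (v j).1, fun j _ => (v j).2⟩
  map_add' _ _ := rfl
  map_smul' _ _ := rfl

instance (p : ℕ) (m : ℤ) : FiniteDimensional ℂ (M.degreePart p m) :=
  (M.degreePartEquiv p m).symm.finiteDimensional

theorem finrank_degreePart (p : ℕ) (m : ℤ) : Module.finrank ℂ (M.degreePart p m) =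
    ∑ j, Module.finrank ℂ (intHomogeneousSubmodule (Fin n) (m - M.deg p j)) := by
  rw [(M.degreePartEquiv p m).finrank_eq, Module.finrank_pi_fintype]

theorem finrank_intHomogeneousSubmodule (r : ℕ) (k : ℕ) :
    Module.finrank ℂ (intHomogeneousSubmodule (Fin (r + 1)) k) = (k + r).choose r := by
  rw [intHomogeneousSubmodule, if_pos (Int.natCast_nonneg k), Int.toNat_natCast,
    homogeneousSubmodule_eq_finsupp_supported,
    (AddMonoidAlgebra.supportedEquivFinsupp {d : Fin (r + 1) →₀ ℕ | d.degree = k}).finrank_eq]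
  have h : {d : Fin (r + 1) →₀ ℕ | d.degree = k} =
      (Finset.univ.finsuppAntidiag k : Finset (Fin (r + 1) →₀ ℕ)) := by
    ext d
    simp [Finsupp.degree_eq_sum]
  rw [h, Module.finrank_finsupp_self]
  simp only [Finset.coe_sort_coe, Fintype.card_coe, Finset.card_finsuppAntidiag_nat_eq_choose,
    Finset.card_univ, Fintype.card_fin]
  rw [Nat.choose_symm_of_eq_add (b := r)] <;> grind

/-- The rank of the differential in degree `m`. -/
noncomputable def differentialRank (p : ℕ) (m : ℤ) : ℕ :=
  Module.finrank ℂ ((M.degreePart (p + 1) m).map (M.differential p))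

theorem hilbertFunction_add_differentialRank (m : ℤ) :
    M.hilbertFunction m + M.differentialRank 0 m = Module.finrank ℂ (M.degreePart 0 m) := by
  have h := Submodule.finrank_map_add_finrank_inf_ker
    ((LinearMap.range (M.d 0).mulVecLin).mkQ.restrictScalars ℂ) (M.degreePart 0 m)
  rw [← h, hilbertFunction, differentialRank, map_degreePart, freeDegreePart_eq]
  have h1 : LinearMap.range (M.differential 0) =
      LinearMap.ker ((LinearMap.range (M.d 0).mulVecLin).mkQ.restrictScalars ℂ) := by
    ext v
    simp [differential]
  rw [h1]

theorem differentialRank_add_differentialRank (p : ℕ) (m : ℤ) :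
    M.differentialRank p m + M.differentialRank (p + 1) m =
      Module.finrank ℂ (M.degreePart (p + 1) m) := by
  have h := Submodule.finrank_map_add_finrank_inf_ker (M.differential p) (M.degreePart (p + 1) m)
  rw [← h, differentialRank, differentialRank, map_degreePart (p := p + 1), range_differential]

/-- Rank–nullity in degree `m`, telescoped along the resolution; the rank of the last differential
is the only remainder. -/
theorem hilbertFunction_eq_sum (m : ℤ) (p : ℕ) : (M.hilbertFunction m : ℤ) =
    ∑ k ∈ Finset.range (p + 1), (-1) ^ k * (Module.finrank ℂ (M.degreePart k m) : ℤ) -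
      (-1) ^ p * M.differentialRank p m := by
  induction p with
  | zero =>
    have h := M.hilbertFunction_add_differentialRank m
    simp [← h]
  | succ p ih =>
    have h := M.differentialRank_add_differentialRank p m
    rw [Finset.sum_range_succ, ih, ← h]
    push_cast
    ring

theorem hilbertFunction_eq_sum_of_rank_eq_zero (m : ℤ) {p : ℕ} (hp : M.rank (p + 1) = 0) :
    (M.hilbertFunction m : ℤ) =
    ∑ k ∈ Finset.range (p + 1), (-1) ^ k * (Module.finrank ℂ (M.degreePart k m) : ℤ) := by
  rw [M.hilbertFunction_eq_sum m p]
  have : IsEmpty (Fin (M.rank (p + 1))) := by rw [hp]; infer_instance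
  have h : M.differentialRank p m = 0 := by
    have h1 : M.degreePart (p + 1) m = ⊥ := Subsingleton.elim _ _
    rw [differentialRank, h1]
    simp
  simp [h]

end MinGradedResolution

/-! ### Herzog–Kühl equations via combinations of translates -/

namespace Polynomial

variable {K ι : Type*} [Field K]

/-- A combination of translates, viewed as an operator on polynomials, commutes with
differentiation; the next results rest on this. -/
theorem derivative_sum_smul_comp_X_sub_C (s : Finset ι) (c d : ι → K) (f : K[X]) :
    derivative (∑ j ∈ s, c j • f.comp (X - C (d j))) =
      ∑ j ∈ s, c j • (derivative f).comp (X - C (d j)) := by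
  simp [derivative_comp]

theorem iterate_derivative_sum_smul_comp_X_sub_C (s : Finset ι) (c d : ι → K) (f : K[X])
    (k : ℕ) : derivative^[k] (∑ j ∈ s, c j • f.comp (X - C (d j))) =
      ∑ j ∈ s, c j • (derivative^[k] f).comp (X - C (d j)) := by
  induction k with
  | zero => simp
  | succ k ih =>
    rw [Function.iterate_succ_apply', ih, derivative_sum_smul_comp_X_sub_C,
      Function.iterate_succ_apply']

variable [CharZero K]

/-- If a combination of translates of a polynomial of degree `r` is constant, then the same
combination of translates of any polynomial of degree less than `r` vanishes. -/
theorem sum_smul_comp_X_sub_C_eq_zero {s : Finset ι} {c d : ι → K} {B : K[X]} {e : K}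
    (hB : ∑ j ∈ s, c j • B.comp (X - C (d j)) = C e) (hB0 : B ≠ 0) {k : ℕ} (hk : k ≤ B.natDegree)
    {f : K[X]} (hf : f.degree < k) : ∑ j ∈ s, c j • f.comp (X - C (d j)) = 0 := by
  induction k generalizing f with
  | zero =>
    have : f = 0 := by simpa using hf
    simp [this]
  | succ k ih =>
    -- A polynomial of exact degree `k`. The operator kills it, because its image is the constant
    -- `e` differentiated at least once. Subtracting a multiple of `g` from `f` lowers the degree.
    set g := derivative^[B.natDegree - k] B with hg
    have hkg : k + (B.natDegree - k) = B.natDegree := by omega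
    have hgk : g.coeff k ≠ 0 := by
      rw [hg, coeff_iterate_derivative, hkg, nsmul_eq_mul]
      refine mul_ne_zero (Nat.cast_ne_zero.2 ?_) (by simpa using hB0)
      rw [Ne, Nat.descFactorial_eq_zero_iff_lt]
      omega
    have hgm : ∀ m, k < m → g.coeff m = 0 := by
      intro m hm
      rw [hg, coeff_iterate_derivative, coeff_eq_zero_of_natDegree_lt (by omega), smul_zero]
    have hTg : ∑ j ∈ s, c j • g.comp (X - C (d j)) = 0 := by
      rw [hg, ← iterate_derivative_sum_smul_comp_X_sub_C, hB, iterate_derivative_C (by omega)]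
    have h1 : ∑ j ∈ s, c j • (f - C (f.coeff k / g.coeff k) * g).comp (X - C (d j)) = 0 := by
      refine ih (by omega) ?_
      rw [degree_lt_iff_coeff_zero] at hf ⊢
      intro m hm
      rw [coeff_sub, coeff_C_mul]
      rcases hm.eq_or_lt with rfl | hm
      · field_simp
        simp
      · rw [hf m hm, hgm m hm]
        simp
    have h2 : ∑ j ∈ s, c j • f.comp (X - C (d j)) =
        ∑ j ∈ s, c j • (f - C (f.coeff k / g.coeff k) * g).comp (X - C (d j)) +
        C (f.coeff k / g.coeff k) * ∑ j ∈ s, c j • g.comp (X - C (d j)) := by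
      rw [Finset.mul_sum, ← Finset.sum_add_distrib]
      refine Finset.sum_congr rfl fun j _ => ?_
      simp [sub_comp, smul_eq_C_mul]
      ring
    rw [h2, h1, hTg]
    simp

/-- If a combination of translates of a polynomial `B` of degree `r` is constant, then this
determines the same combination of translates of any polynomial of degree at most `r`. -/
theorem sum_smul_comp_X_sub_C_eq_C {s : Finset ι} {c d : ι → K} {B : K[X]} {e : K}
    (hB : ∑ j ∈ s, c j • B.comp (X - C (d j)) = C e) (hB0 : B ≠ 0)
    {f : K[X]} (hf : f.natDegree ≤ B.natDegree) :
    ∑ j ∈ s, c j • f.comp (X - C (d j)) = C (f.coeff B.natDegree / B.leadingCoeff * e) := by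
  have hl : B.leadingCoeff ≠ 0 := by simpa using hB0
  set a := f.coeff B.natDegree / B.leadingCoeff
  have h1 : ∑ j ∈ s, c j • (f - C a * B).comp (X - C (d j)) = 0 := by
    refine sum_smul_comp_X_sub_C_eq_zero hB hB0 le_rfl ?_
    rw [degree_lt_iff_coeff_zero]
    intro m hm
    rw [coeff_sub, coeff_C_mul]
    rcases hm.eq_or_lt with rfl | hm
    · rw [coeff_natDegree]
      simp only [a]
      field_simp
      simp
    · rw [coeff_eq_zero_of_natDegree_lt hm, coeff_eq_zero_of_natDegree_lt (hf.trans_lt hm)]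
      simp
  have h2 : ∑ j ∈ s, c j • f.comp (X - C (d j)) =
      ∑ j ∈ s, c j • (f - C a * B).comp (X - C (d j)) +
      C a * ∑ j ∈ s, c j • B.comp (X - C (d j)) := by
    rw [Finset.mul_sum, ← Finset.sum_add_distrib]
    refine Finset.sum_congr rfl fun j _ => ?_
    simp [sub_comp, smul_eq_C_mul]
    ring
  rw [h2, h1, hB, zero_add, C_mul]

/-- The Herzog–Kühl equations, solved: if the alternating sum of the Hilbert polynomials of
`r + 1` shifted free modules is the constant `e`, then this determines the coefficients. -/
theorem coeff_mul_prod_eq_of_hilbert_const [DecidableEq ι] {r : ℕ} {s : Finset ι}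
    (hs : s.card = r + 1) {c : ι → K} {d : ι → ℕ} {e : K}
    (h : ∀ᶠ m : ℕ in atTop, ∑ j ∈ s, c j * ((m - d j + r).choose r : K) = e) {p : ι}
    (hp : p ∈ s) : c p * ∏ j ∈ s.erase p, ((d j : K) - d p) = e * r.factorial := by
  have hB : ∑ j ∈ s, c j • (preHilbertPoly K r 0).comp (X - C (d j : K)) = C e := by
    refine eq_of_infinite_eval_eq _ _ ?_
    -- Beyond all shifts the truncated subtraction `m - d j` is genuine, and the binomial
    -- coefficient is the value of a polynomial.
    obtain ⟨N, hN⟩ := eventually_atTop.1 (h.and (eventually_ge_atTop (s.sup d)))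
    refine Set.Infinite.mono (s := (fun m : ℕ => (m : K)) '' Set.Ici N) ?_
      ((Set.Ici_infinite N).image Nat.cast_injective.injOn)
    rintro _ ⟨m, hm, rfl⟩
    obtain ⟨h1, h2⟩ := hN m hm
    simp only [Set.mem_ofPred_eq, eval_finsetSum, eval_smul, eval_comp, eval_sub, eval_X, eval_C,
      smul_eq_mul]
    rw [← h1]
    refine Finset.sum_congr rfl fun j hj => ?_
    have h3 : d j ≤ m := (Finset.le_sup hj).trans h2
    rw [← Nat.cast_sub h3, preHilbertPoly_eq_choose_sub_add K r (Nat.zero_le _)]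
    simp
  have hB0 : preHilbertPoly K r 0 ≠ 0 := by
    intro h0
    have := leadingCoeff_preHilbertPoly K r 0
    rw [h0, leadingCoeff_zero] at this
    exact inv_ne_zero (Nat.cast_ne_zero.2 (Nat.factorial_ne_zero r)) this.symm
  -- A monic test polynomial of degree `r` vanishing at `-d j` for `j ≠ p`: evaluating its
  -- combination of translates at 0 isolates `c p`.
  set f : K[X] := ∏ j ∈ s.erase p, (X + C (d j : K)) with hf
  have hfd : f.natDegree = r := by
    rw [hf, natDegree_prod_of_monic _ _ fun j _ => monic_X_add_C _]
    simp only [natDegree_X_add_C, Finset.sum_const, Finset.card_erase_of_mem hp, hs]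
    simp
  have hfm : f.Monic := monic_prod_of_monic _ _ fun j _ => monic_X_add_C _
  have hBd : (preHilbertPoly K r 0).natDegree = r := natDegree_preHilbertPoly K r 0
  have h1 := congrArg (eval 0) (sum_smul_comp_X_sub_C_eq_C hB hB0 (f := f) (by rw [hfd, hBd]))
  have hfc : f.coeff r = 1 := by
    have := hfm.coeff_natDegree
    rwa [hfd] at this
  rw [hBd, hfc, leadingCoeff_preHilbertPoly, eval_C, eval_finsetSum,
    Finset.sum_eq_single_of_mem p hp] at h1
  · simp only [eval_smul, eval_comp, eval_sub, eval_X, eval_C, hf, eval_prod, eval_add,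
      smul_eq_mul] at h1
    rw [show e * (r.factorial : K) = 1 / (r.factorial : K)⁻¹ * e by simp [mul_comm], ← h1]
    congr 1
    exact Finset.prod_congr rfl fun j _ => by ring
  · intro j hj hjp
    simp only [eval_smul, eval_comp, eval_sub, eval_X, eval_C, hf, eval_prod, eval_add,
      smul_eq_mul]
    rw [Finset.prod_eq_zero (Finset.mem_erase.2 ⟨hjp, hj⟩) (by ring), mul_zero]

end Polynomial

/-! ### Betti numbers of the pure modules -/

theorem Finset.prod_range_erase_sub {K : Type*} [CommRing K] (a b : ℕ) :
    ∏ t ∈ (Finset.range (a + b + 1)).erase a, ((t : K) - a) =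
      (-1) ^ a * a.factorial * b.factorial := by
  induction b with
  | zero =>
    have h : (Finset.range (a + 1)).erase a = Finset.range a := by
      ext; simp; omega
    rw [add_zero, h, ← Finset.prod_range_reflect, ← Finset.prod_range_add_one_eq_factorial]
    rw [Nat.cast_prod, Nat.factorial_zero, Nat.cast_one, mul_one]
    rw [show ((-1 : K)) ^ a = ∏ t ∈ Finset.range a, (-1 : K) by simp, ← Finset.prod_mul_distrib]
    refine Finset.prod_congr rfl fun t ht => ?_
    rw [Finset.mem_range] at ht
    rw [Nat.cast_sub (by omega), Nat.cast_sub (by omega)]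
    push_cast
    ring
  | succ b ih =>
    have h : (Finset.range (a + (b + 1) + 1)).erase a =
        insert (a + b + 1) ((Finset.range (a + b + 1)).erase a) := by
      ext; simp; omega
    rw [h, Finset.prod_insert (by simp), ih, Nat.factorial_succ]
    push_cast
    ring

namespace MinGradedResolution

open MvPolynomial

/-- Shifted degrees of the pure resolution: all natural numbers except `i`. -/
def pureShift (i p : ℕ) : ℕ := if p < i then p else p + 1

theorem pureShift_injective (i : ℕ) : Function.Injective (pureShift i) := by
  intro p q h
  unfold pureShift at h
  split_ifs at h <;> omega

theorem image_pureShift {i r : ℕ} (hi : i ≤ r) :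
    (Finset.range (r + 1)).image (pureShift i) = (Finset.range (r + 2)).erase i := by
  ext t
  simp only [Finset.mem_image, Finset.mem_range, Finset.mem_erase, pureShift]
  constructor
  · rintro ⟨p, hp, rfl⟩
    split_ifs <;> omega
  · rintro ⟨h1, h2⟩
    rcases lt_or_gt_of_ne h1 with h | h
    · exact ⟨t, by omega, by simp [h]⟩
    · exact ⟨t - 1, by omega, by rw [if_neg (by omega)]; omega⟩

/-- The factor `i - pureShift i p` restores the one missing shift, completing the product to all of
`0, …, r+1` and hence to factorials. -/
theorem prod_pureShift_sub {i r p : ℕ} (hi : i ≤ r) (hp : p ≤ r) :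
    (∏ j ∈ (Finset.range (r + 1)).erase p, ((pureShift i j : ℝ) - pureShift i p)) *
      ((i : ℝ) - pureShift i p) = (-1) ^ pureShift i p * (pureShift i p).factorial *
        (r + 1 - pureShift i p).factorial := by
  have hpi : pureShift i p ≤ r + 1 := by unfold pureShift; split_ifs <;> omega
  have hne : pureShift i p ≠ i := by unfold pureShift; split_ifs <;> omega
  have h := Finset.prod_range_erase_sub (K := ℝ) (pureShift i p) (r + 1 - pureShift i p)
  rw [show pureShift i p + (r + 1 - pureShift i p) + 1 = r + 2 by omega] at h
  rw [← h, ← Finset.prod_erase_mul (a := i) _ _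
    (Finset.mem_erase.2 ⟨hne.symm, Finset.mem_range.2 (by omega)⟩), Finset.erase_right_comm,
    ← image_pureShift hi, ← Finset.image_erase (pureShift_injective i),
    Finset.prod_image (pureShift_injective i).injOn]

variable {r i : ℕ} {M : MinGradedResolution (r + 1)}

theorem HasPureShape.deg_eq (h : M.HasPureShape r i) (hi : i ≤ r) (p : ℕ) (j : Fin (M.rank p)) :
    p ≤ r ∧ M.deg p j = pureShift i p + 1 := by
  -- The generator `j` itself makes a Betti number in column `p` nonzero, and the shape allows only
  -- one row there.
  have h1 := (h p (M.deg p j - p)).1 (by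
    rw [betti, Finset.card_ne_zero]
    exact ⟨j, by simp⟩)
  unfold pureShift
  split_ifs <;> omega

theorem HasPureShape.betti_eq_rank (h : M.HasPureShape r i) (hi : i ≤ r) {p : ℕ} {q : ℤ}
    (hq : (pureShift i p : ℤ) + 1 = p + q) : M.betti p q = M.rank p := by
  rw [betti, Finset.filter_true_of_mem, Finset.card_univ, Fintype.card_fin]
  intro j _
  rw [(h.deg_eq hi p j).2, hq]

theorem HasPureShape.rank_eq_zero (h : M.HasPureShape r i) (hi : i ≤ r) {p : ℕ} (hp : r < p) :
    M.rank p = 0 := by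
  by_contra h0
  have := (h.deg_eq hi p ⟨0, Nat.pos_of_ne_zero h0⟩).1
  omega

theorem HasPureShape.hilbertFunction_eq (h : M.HasPureShape r i) (hi : i ≤ r) {m : ℕ} (hm : r + 2 ≤ m) :
    (M.hilbertFunction m : ℤ) = ∑ p ∈ Finset.range (r + 1),
      ((-1) ^ p * M.rank p : ℤ) * ((m - (pureShift i p + 1) + r).choose r : ℕ) := by
  rw [M.hilbertFunction_eq_sum_of_rank_eq_zero m (h.rank_eq_zero hi (Nat.lt_succ_self r))]
  refine Finset.sum_congr rfl fun p hp => ?_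
  rw [Finset.mem_range] at hp
  -- The largest generator degree is at most `r + 2`, hence the bound on `m`.
  have hpi : pureShift i p + 1 ≤ m := by unfold pureShift; split_ifs <;> omega
  rw [finrank_degreePart, Finset.sum_congr rfl fun j _ => by
    rw [(h.deg_eq hi p j).2, show (m : ℤ) - (pureShift i p + 1) = (m - (pureShift i p + 1) : ℕ) by
      omega, finrank_intHomogeneousSubmodule]]
  simp
  ring

theorem HasPureShape.rank_mul_prod (h : M.HasPureShape r i) (hi : i ≤ r) {e : ℕ}
    (he : M.IsOneDimOfMultiplicity e) {p : ℕ} (hp : p ≤ r) :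
    ((-1) ^ p * M.rank p : ℝ) *
      ∏ j ∈ (Finset.range (r + 1)).erase p, ((pureShift i j : ℝ) - pureShift i p) =
        e * r.factorial := by
  have h1 := Polynomial.coeff_mul_prod_eq_of_hilbert_const (K := ℝ) (r := r)
    (s := Finset.range (r + 1)) (by simp) (c := fun p => (-1) ^ p * M.rank p)
    (d := fun p => pureShift i p + 1) (e := e) ?_ (p := p) (by simpa [Nat.lt_succ_iff] using hp)
  · simpa using h1
  · filter_upwards [tendsto_natCast_atTop_atTop.eventually he.2, eventually_ge_atTop (r + 2)]
      with m hm hm2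
    have h2 := h.hilbertFunction_eq hi hm2
    rw [hm] at h2
    have h3 := congrArg (fun z : ℤ => (z : ℝ)) h2
    simp only [Int.cast_natCast] at h3
    rw [h3]
    push_cast
    rfl

theorem HasPureShape.rank_mul_factorial (h : M.HasPureShape r i) (hi : i ≤ r) {e : ℕ}
    (he : M.IsOneDimOfMultiplicity e) {p : ℕ} (hp : p ≤ r) :
    (M.rank p : ℝ) * ((-1) ^ p * (-1) ^ pureShift i p) * ((pureShift i p).factorial *
        (r + 1 - pureShift i p).factorial) = e * r.factorial * ((i : ℝ) - pureShift i p) := by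
  rw [← h.rank_mul_prod hi he hp, mul_assoc _ (∏ j ∈ _, _), prod_pureShift_sub hi hp]
  ring

theorem HasPureShape.betti_one (h : M.HasPureShape r i) (hi : i ≤ r) {e : ℕ}
    (he : M.IsOneDimOfMultiplicity e) (p : ℕ) :
    (M.betti p 1 : ℝ) = ((r + 1).choose p / (r + 1)) * (e * max ((i : ℝ) - p) 0) := by
  by_cases hp : p < i
  · have hs : pureShift i p = p := by simp [pureShift, hp]
    have h1 := h.rank_mul_factorial hi he (p := p) (by omega)
    rw [hs, ← mul_pow] at h1
    rw [h.betti_eq_rank hi (by omega), max_eq_left (by simpa using hp.le),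
      Nat.cast_choose ℝ (by omega : p ≤ r + 1), Nat.factorial_succ]
    push_cast
    field_simp
    simpa [mul_assoc, mul_comm, mul_left_comm] using h1
  · have h1 : M.betti p 1 = 0 := by
      by_contra h0
      have := (h p 1).1 h0
      omega
    rw [h1, max_eq_right (by simpa using not_lt.1 hp)]
    simp

/-- Same form as the first row, with `p + 1` for `p` and the sign inside the truncation reversed, so
that both rows can be treated together. Outside `i ≤ p ≤ r` either the truncation or the binomial
coefficient vanishes. -/
theorem HasPureShape.betti_two (h : M.HasPureShape r i) (hi : i ≤ r) {e : ℕ}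
    (he : M.IsOneDimOfMultiplicity e) (p : ℕ) :
    (M.betti p 2 : ℝ) = ((r + 1).choose (p + 1) / (r + 1)) *
      (e * max (-((i : ℝ) - (p + 1 : ℕ))) 0) := by
  by_cases hp : i ≤ p ∧ p ≤ r
  · have hs : pureShift i p = p + 1 := by simp [pureShift, hp.1]
    have h1 := h.rank_mul_factorial hi he hp.2
    rw [hs, ← pow_add] at h1
    have hip : (i : ℝ) ≤ p := by exact_mod_cast hp.1
    rw [h.betti_eq_rank hi (by omega), max_eq_left (by push_cast; linarith),
      Nat.cast_choose ℝ (by omega : p + 1 ≤ r + 1), Nat.factorial_succ r]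
    rw [show (-1 : ℝ) ^ (p + (p + 1)) = -1 by
      rw [← add_assoc, pow_succ, ← two_mul, pow_mul]; simp] at h1
    push_cast at h1 ⊢
    field_simp
    linear_combination -h1
  · have h1 : M.betti p 2 = 0 := by
      by_contra h0
      have := (h p 2).1 h0
      omega
    rw [h1]
    rcases not_and_or.1 hp with h2 | h2
    · have hip : (p : ℝ) + 1 ≤ i := by exact_mod_cast not_le.1 h2
      rw [max_eq_right (by push_cast; linarith)]
      simp
    · rw [Nat.choose_eq_zero_of_lt (by omega)]
      simp

end MinGradedResolution

/-! ### Local limit theorem for binomial coefficients -/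

theorem Real.abs_entropy_sub_sq_le {u : ℝ} (hu : |u| ≤ 1 / 2) :
    |(1 + u) * Real.log (1 + u) + (1 - u) * Real.log (1 - u) - u ^ 2| ≤ 6 * |u| ^ 3 := by
  have h1 := Real.abs_log_sub_add_sum_range_le (x := u) (by linarith) 2
  have h2 := Real.abs_log_sub_add_sum_range_le (x := -u) (by rw [abs_neg]; linarith) 2
  rw [abs_neg] at h2
  have h3 : |u| ^ (2 + 1) / (1 - |u|) ≤ 2 * |u| ^ 3 := by
    rw [div_le_iff₀ (by linarith)]
    have h := mul_nonneg (pow_nonneg (abs_nonneg u) 3) (sub_nonneg.2 hu)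
    rw [show |u| ^ (2 + 1) = |u| ^ 3 by norm_num]
    linarith
  replace h1 := h1.trans h3
  replace h2 := h2.trans h3
  simp only [Finset.sum_range_succ, Finset.sum_range_zero] at h1 h2
  norm_num at h1 h2
  have hu' := abs_le.1 hu
  -- The quadratic Taylor polynomials contribute exactly `-u²`, so only the two logarithm remainders
  -- are left.
  have h4 : (1 + u) * Real.log (1 + u) + (1 - u) * Real.log (1 - u) - u ^ 2 =
      (1 + u) * (-u + u ^ 2 / 2 + Real.log (1 + u)) +
      (1 - u) * (u + u ^ 2 / 2 + Real.log (1 - u)) := by ring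
  rw [h4]
  refine (abs_add_le _ _).trans ?_
  rw [abs_mul, abs_mul, abs_of_nonneg (by linarith : 0 ≤ 1 + u),
    abs_of_nonneg (by linarith : 0 ≤ 1 - u)]
  calc _ ≤ (1 + u) * (2 * |u| ^ 3) + (1 - u) * (2 * |u| ^ 3) := by
        gcongr <;> linarith
    _ ≤ _ := by nlinarith [pow_nonneg (abs_nonneg u) 3]

theorem Nat.factorial_eq_stirlingSeq_mul {n : ℕ} (hn : n ≠ 0) :
    (n.factorial : ℝ) = Stirling.stirlingSeq n * (√(2 * n) * (n / Real.exp 1) ^ n) := by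
  have h : (n : ℝ) ≠ 0 := Nat.cast_ne_zero.2 hn
  rw [Stirling.stirlingSeq, div_mul_cancel₀]
  have : (0 : ℝ) < n := by positivity
  positivity

/-- Stirling's formula kept exact: the powers of `e` cancel, and the remaining powers combine into
the entropy exponential. -/
theorem Nat.choose_mul_sqrt_div_two_pow {n s t : ℕ} (hst : s + t = n) (hs : s ≠ 0) (ht : t ≠ 0)
    {u : ℝ} (hu : (s : ℝ) = n * (1 + u) / 2) :
    (n.choose s : ℝ) * (√n / 2 ^ n) =
      Stirling.stirlingSeq n / (Stirling.stirlingSeq s * Stirling.stirlingSeq t) *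
        (√2 / √(1 - u ^ 2)) *
        Real.exp (-(n / 2 * ((1 + u) * Real.log (1 + u) + (1 - u) * Real.log (1 - u)))) := by
  have hn : n ≠ 0 := by omega
  have hs0 : (0 : ℝ) < s := by positivity
  have ht0 : (0 : ℝ) < t := by positivity
  have hn0 : (0 : ℝ) < n := by positivity
  have hstR : (s : ℝ) + t = n := by exact_mod_cast hst
  have htu : (t : ℝ) = n * (1 - u) / 2 := by linarith
  have hu1 : 0 < 1 + u := by
    by_contra h
    nlinarith
  have hu2 : 0 < 1 - u := by
    by_contra h
    nlinarith
  have hexp : Real.exp (-(n / 2 * ((1 + u) * Real.log (1 + u) + (1 - u) * Real.log (1 - u)))) =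
      ((1 + u) ^ s * (1 - u) ^ t)⁻¹ := by
    rw [Real.exp_neg, ← Real.exp_log (pow_pos hu1 s), ← Real.exp_log (pow_pos hu2 t),
      ← Real.exp_add, Real.log_pow, Real.log_pow, hu, htu]
    congr 2
    ring
  have hpow : ((s : ℝ) / Real.exp 1) ^ s * (t / Real.exp 1) ^ t =
      (n / Real.exp 1) ^ n / 2 ^ n * ((1 + u) ^ s * (1 - u) ^ t) := by
    have h1 : (s : ℝ) / Real.exp 1 = n / Real.exp 1 / 2 * (1 + u) := by rw [hu]; ring
    have h2 : (t : ℝ) / Real.exp 1 = n / Real.exp 1 / 2 * (1 - u) := by rw [htu]; ring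
    rw [h1, h2, mul_pow, mul_pow, ← div_pow, ← hst, pow_add]
    ring
  have hsqrt : √(2 * s) * √(2 * t) = n * √(1 - u ^ 2) := by
    rw [← Real.sqrt_mul (by positivity), hu, htu,
      show 2 * ((n : ℝ) * (1 + u) / 2) * (2 * (n * (1 - u) / 2)) = n ^ 2 * (1 - u ^ 2) by ring,
      Real.sqrt_mul (by positivity), Real.sqrt_sq hn0.le]
  have hsqrt2 : √(2 * n) * √n = √2 * n := by
    rw [Real.sqrt_mul (by positivity), mul_assoc, Real.mul_self_sqrt hn0.le]
  have hu3 : 0 < √(1 - u ^ 2) := Real.sqrt_pos.2 (by nlinarith)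
  have hSs : Stirling.stirlingSeq s ≠ 0 := by unfold Stirling.stirlingSeq; positivity
  have hSt : Stirling.stirlingSeq t ≠ 0 := by unfold Stirling.stirlingSeq; positivity
  rw [hexp, Nat.cast_choose ℝ (by omega : s ≤ n), show n - s = t by omega,
    factorial_eq_stirlingSeq_mul hn, factorial_eq_stirlingSeq_mul hs,
    factorial_eq_stirlingSeq_mul ht]
  rw [show ∀ A B C D E F : ℝ, A * (B * C) * (D * (E * F)) = A * D * ((B * E) * (C * F)) by
    intros; ring, hpow, hsqrt]
  rw [show ∀ A B C D E : ℝ, A * (B * C) / D * E = A / D * ((B * C) * E) by intros; ring]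
  have he : (n / Real.exp 1 : ℝ) ^ n ≠ 0 := by positivity
  generalize √(2 * (n : ℝ)) = w at hsqrt2 ⊢
  field_simp
  linear_combination Stirling.stirlingSeq n * hsqrt2

/-- The local limit theorem for the symmetric binomial distribution. -/
theorem Nat.tendsto_choose_mul_sqrt_div_two_pow {ι : Type*} {l : Filter ι} {n s : ι → ℕ} {a : ℝ}
    (hn : Tendsto n l atTop)
    (h : Tendsto (fun j => (2 * (s j : ℝ) - n j) / √(n j)) l (𝓝 a)) :
    Tendsto (fun j => ((n j).choose (s j) : ℝ) * (√(n j) / 2 ^ n j) * √(Real.pi / 2)) l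
      (𝓝 (Real.exp (-a ^ 2 / 2))) := by
  set u : ι → ℝ := fun j => (2 * (s j : ℝ) - n j) / n j with hu
  have hnR : Tendsto (fun j => (n j : ℝ)) l atTop := tendsto_natCast_atTop_atTop.comp hn
  have hn1 : ∀ᶠ j in l, 1 ≤ n j := hn.eventually_ge_atTop 1
  have hnu : Tendsto (fun j => n j * u j ^ 2) l (𝓝 (a ^ 2)) := by
    refine (h.pow 2).congr' ?_
    filter_upwards [hn1] with j hj
    have : (0 : ℝ) < n j := by positivity
    rw [hu, div_pow, div_pow, Real.sq_sqrt this.le]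
    field_simp
  have hu0 : Tendsto u l (𝓝 0) := by
    have h1 := h.mul (tendsto_inv_atTop_zero.comp (Real.tendsto_sqrt_atTop.comp hnR))
    rw [mul_zero] at h1
    refine h1.congr' ?_
    filter_upwards [hn1] with j hj
    have : (0 : ℝ) < n j := by positivity
    simp only [hu, Function.comp]
    rw [← div_eq_mul_inv, div_div, Real.mul_self_sqrt this.le]
  have habs : ∀ᶠ j in l, |u j| ≤ 1 / 2 := by
    have := hu0.abs
    rw [abs_zero] at this
    exact this.eventually_le_const (by norm_num)
  have hsu : ∀ᶠ j in l, (s j : ℝ) = n j * (1 + u j) / 2 := by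
    filter_upwards [hn1] with j hj
    have : (0 : ℝ) < n j := by positivity
    simp only [hu]
    field_simp
    ring
  have hquarter : Tendsto (fun j => (n j : ℝ) / 4) l atTop := hnR.atTop_div_const (by norm_num)
  have hs4 : ∀ᶠ j in l, (n j : ℝ) / 4 ≤ s j := by
    filter_upwards [hsu, habs] with j h1 h2
    rw [h1]
    nlinarith [(abs_le.1 h2).1, Nat.cast_nonneg (α := ℝ) (n j)]
  have hle : ∀ᶠ j in l, s j ≤ n j := by
    filter_upwards [hsu, habs] with j h1 h2
    rw [← Nat.cast_le (α := ℝ), h1]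
    nlinarith [(abs_le.1 h2).2, Nat.cast_nonneg (α := ℝ) (n j)]
  have ht4 : ∀ᶠ j in l, (n j : ℝ) / 4 ≤ (n j - s j : ℕ) := by
    filter_upwards [hsu, habs, hle] with j h1 h2 h3
    rw [Nat.cast_sub h3, h1]
    nlinarith [(abs_le.1 h2).2, Nat.cast_nonneg (α := ℝ) (n j)]
  have hs : Tendsto s l atTop :=
    tendsto_natCast_atTop_iff.1 (tendsto_atTop_mono' l hs4 hquarter)
  have ht : Tendsto (fun j => n j - s j) l atTop :=
    tendsto_natCast_atTop_iff.1 (tendsto_atTop_mono' l ht4 hquarter)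
  have hS := Stirling.tendsto_stirlingSeq_sqrt_pi
  have hpi : √Real.pi ≠ 0 := by positivity
  have hent : Tendsto (fun j => (n j : ℝ) / 2 * ((1 + u j) * Real.log (1 + u j) +
      (1 - u j) * Real.log (1 - u j))) l (𝓝 (a ^ 2 / 2)) := by
    -- Bound for the cubic entropy error: `n u²` stays bounded while `u → 0`.
    have h1 : Tendsto (fun j => 3 * (n j * u j ^ 2) * |u j|) l (𝓝 0) := by
      have := (hnu.const_mul 3).mul hu0.abs
      simpa using this
    have h2 : Tendsto (fun j => (n j : ℝ) / 2 * ((1 + u j) * Real.log (1 + u j) +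
      (1 - u j) * Real.log (1 - u j)) - n j * u j ^ 2 / 2) l (𝓝 0) := by
      refine squeeze_zero_norm' ?_ h1
      filter_upwards [habs] with j hj
      rw [Real.norm_eq_abs, show ∀ A B C : ℝ, A / 2 * B - A * C / 2 = A / 2 * (B - C) by
        intros; ring, abs_mul, abs_of_nonneg (by positivity)]
      calc _ ≤ (n j : ℝ) / 2 * (6 * |u j| ^ 3) := by
            gcongr
            exact Real.abs_entropy_sub_sq_le hj
        _ = _ := by rw [← sq_abs (u j)]; ring
    have h3 := h2.add (hnu.div_const 2)
    simpa using h3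
  have hmain := (((hS.comp hn).div ((hS.comp hs).mul (hS.comp ht)) (mul_ne_zero hpi hpi)).mul
    (((tendsto_const_nhds (x := √2)).div
      ((tendsto_const_nhds (x := (1 : ℝ))).sub (hu0.pow 2)).sqrt (by simp)))).mul
      (Real.continuous_exp.tendsto _ |>.comp hent.neg) |>.mul_const (√(Real.pi / 2))
  have hlim : √Real.pi / (√Real.pi * √Real.pi) * (√2 / √(1 - 0 ^ 2)) * Real.exp (-(a ^ 2 / 2)) *
      √(Real.pi / 2) = Real.exp (-a ^ 2 / 2) := by
    rw [Real.sqrt_div Real.pi_pos.le, neg_div]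
    have h2 : √(2 : ℝ) ≠ 0 := by positivity
    simp
    field_simp
  rw [hlim] at hmain
  refine hmain.congr' ?_
  filter_upwards [hle, hsu, hs.eventually_ge_atTop 1, ht.eventually_ge_atTop 1] with j h1 h2 h3 h4
  rw [Nat.choose_mul_sqrt_div_two_pow (Nat.add_sub_cancel' h1) (by omega) (by omega) h2]
  rfl

/-- The binomials have upper index `r + 1` and lower index `p + s₀`; `b = 2 s₀ - 1` turns `2p - r`
into `2(p + s₀) - (r + 1)`. -/
theorem tendsto_two_mul_sub_succ_div_sqrt {s : ℕ → ℕ} {a : ℝ}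
    (h : Tendsto (fun r : ℕ => (2 * (s r : ℝ) - r) / √r) atTop (𝓝 a)) (b : ℝ) :
    Tendsto (fun r : ℕ => (2 * (s r : ℝ) - r + b) / √(r + 1 : ℕ)) atTop (𝓝 a) := by
  have h1 : Tendsto (fun r : ℕ => √((r : ℝ) / (r + 1))) atTop (𝓝 1) := by
    have := (tendsto_natCast_div_add_atTop (𝕜 := ℝ) 1).sqrt
    simpa using this
  have h2 : Tendsto (fun r : ℕ => b / √((r + 1 : ℕ) : ℝ)) atTop (𝓝 0) :=
    (Real.tendsto_sqrt_atTop.comp (tendsto_natCast_atTop_atTop.comp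
      (tendsto_add_atTop_nat 1))).const_div_atTop b
  have h3 := (h.mul h1).add h2
  rw [mul_one, add_zero] at h3
  refine h3.congr' ?_
  filter_upwards [eventually_ge_atTop 1] with r hr
  have : (0 : ℝ) < r := by positivity
  rw [Real.sqrt_div this.le]
  push_cast
  have h4 : √(r : ℝ) ≠ 0 := by positivity
  field_simp

/-! ### Concentration for uniform points of a cube -/

namespace ProbabilityTheory

/-- Lebesgue measure on the unit interval. -/
noncomputable abbrev unitUniform : Measure ℝ := volume.restrict (Set.Icc 0 1)

instance : IsProbabilityMeasure unitUniform := ⟨by simp⟩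

variable {ι : Type*} [Fintype ι]

theorem cond_volume_Icc_eq_pi :
    ProbabilityTheory.cond (volume : Measure (ι → ℝ)) (Set.Icc 0 1) =
      Measure.pi fun _ => unitUniform := by
  have h : (volume : Measure (ι → ℝ)) (Set.Icc 0 1) = 1 := by
    simp [Real.volume_Icc_pi]
  rw [ProbabilityTheory.cond, h, inv_one, one_smul, ← Set.pi_univ_Icc, volume_pi,
    Measure.restrict_pi_pi]
  rfl

theorem integral_sub_half_mul_unitUniform (c : ℝ) :
    ∫ y, (y - 1 / 2) * c ∂unitUniform = 0 := by
  rw [integral_mul_const, integral_Icc_eq_integral_Ioc,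
    ← intervalIntegral.integral_of_le zero_le_one]
  simp

/-- Hoeffding's lemma for a centred variable with values in `[-b/2, b/2]`. -/
theorem hasSubgaussianMGF_sub_half_mul {b c : ℝ} (hc : |c| ≤ b) :
    HasSubgaussianMGF (fun y => (y - 1 / 2) * c) ((‖b‖₊ / 2) ^ 2) unitUniform := by
  have h := hasSubgaussianMGF_of_mem_Icc_of_integral_eq_zero (μ := unitUniform)
    (X := fun y => (y - 1 / 2) * c) (a := -(b / 2)) (b := b / 2)
    (by fun_prop) ?_ (integral_sub_half_mul_unitUniform c)
  · rwa [show b / 2 - -(b / 2) = b by ring] at h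
  · filter_upwards [ae_restrict_mem measurableSet_Icc] with y hy
    rw [Set.mem_Icc, ← abs_le, abs_mul]
    have h1 : |y - 1 / 2| ≤ 1 / 2 := abs_le.2 ⟨by linarith [hy.1], by linarith [hy.2]⟩
    nlinarith [abs_nonneg c, abs_nonneg (y - 1 / 2)]

theorem measure_le_sum_sub_half_mul_le {b : ℝ} {c : ι → ℝ} (hc : ∀ i, |c i| ≤ b) {ε : ℝ}
    (hε : 0 ≤ ε) :
    (Measure.pi fun _ : ι => unitUniform).real {y | ε ≤ ∑ i, (y i - 1 / 2) * c i} ≤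
      Real.exp (-ε ^ 2 / (2 * (Fintype.card ι * (b / 2) ^ 2))) := by
  have h := HasSubgaussianMGF.measure_sum_ge_le_of_iIndepFun
    (μ := Measure.pi fun _ : ι => unitUniform) (s := Finset.univ)
    (X := fun i y => (y i - 1 / 2) * c i) (c := fun _ => (‖b‖₊ / 2) ^ 2)
    (iIndepFun_pi (X := fun i y => (y - 1 / 2) * c i) fun i => by fun_prop) ?_ hε
  · simpa [Finset.sum_const, div_pow] using h
  · intro i _
    have h1 := hasSubgaussianMGF_sub_half_mul (hc i)
    have h2 := measurePreserving_eval (fun _ : ι => unitUniform) i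
    rw [← h2.map_eq] at h1
    exact HasSubgaussianMGF.of_map h2.measurable.aemeasurable h1

theorem measure_le_abs_sum_sub_half_mul_le {b : ℝ} {c : ι → ℝ} (hc : ∀ i, |c i| ≤ b) {ε : ℝ}
    (hε : 0 ≤ ε) :
    (Measure.pi fun _ : ι => unitUniform).real {y | ε ≤ |∑ i, (y i - 1 / 2) * c i|} ≤
      2 * Real.exp (-ε ^ 2 / (2 * (Fintype.card ι * (b / 2) ^ 2))) := by
  have h1 := measure_le_sum_sub_half_mul_le hc hε
  have h2 := measure_le_sum_sub_half_mul_le (c := fun i => -c i) (by simpa using hc) hε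
  refine (measureReal_mono ?_).trans ((measureReal_union_le _ _).trans
    ((add_le_add h1 h2).trans_eq (two_mul _).symm))
  intro y hy
  have hy' : ε ≤ |∑ i, (y i - 1 / 2) * c i| := hy
  rcases le_abs.1 hy' with h | h
  · exact Or.inl h
  · refine Or.inr ?_
    simpa using h

variable {Ω : Type*} [MeasurableSpace Ω] {P : Measure Ω}

theorem map_eq_pi_of_isUniform {x : Ω → ι → ℝ} (hx : pdf.IsUniform x (Set.Icc 0 1) P volume) :
    P.map x = Measure.pi fun _ => unitUniform := by
  rw [← cond_volume_Icc_eq_pi]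
  exact hx

/-- Measurability comes for free: otherwise the pushforward would be the zero measure, not a
probability measure. -/
theorem aemeasurable_of_isUniform {x : Ω → ι → ℝ}
    (hx : pdf.IsUniform x (Set.Icc 0 1) P volume) : AEMeasurable x P :=
  AEMeasurable.of_map_ne_zero (by
    rw [map_eq_pi_of_isUniform hx]
    exact IsProbabilityMeasure.ne_zero _)

theorem ae_mem_Icc_of_isUniform {x : Ω → ι → ℝ}
    (hx : pdf.IsUniform x (Set.Icc 0 1) P volume) : ∀ᵐ ω ∂P, x ω ∈ Set.Icc (0 : ι → ℝ) 1 := by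
  refine ae_of_ae_map (p := fun y => y ∈ Set.Icc (0 : ι → ℝ) 1) (aemeasurable_of_isUniform hx) ?_
  rw [hx, ProbabilityTheory.cond]
  exact Measure.ae_smul_measure (ae_restrict_mem measurableSet_Icc) _

/-- A strong law of large numbers for an array of independent uniform variables in each row, with
arbitrary dependence between the rows. -/
theorem ae_tendsto_sum_sub_half_mul_div_sq {κ : ℕ → Type*} [∀ r, Fintype (κ r)]
    {x : (r : ℕ) → Ω → κ r → ℝ} (hx : ∀ r, pdf.IsUniform (x r) (Set.Icc 0 1) P volume)
    [IsProbabilityMeasure P]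
    {c : (r : ℕ) → κ r → ℝ} {K : ℝ} (hK : 0 < K) (hc : ∀ r i, |c r i| ≤ K * r)
    (hκ : ∀ r, Fintype.card (κ r) ≤ r + 1) :
    ∀ᵐ ω ∂P, Tendsto (fun r : ℕ => (∑ i, (x r ω i - 1 / 2) * c r i) / (r : ℝ) ^ 2) atTop
      (𝓝 0) := by
  have key (k : ℕ) : ∀ᵐ ω ∂P, ∀ᶠ r : ℕ in atTop,
      |∑ i, (x r ω i - 1 / 2) * c r i| < 1 / ((k : ℝ) + 1) * (r : ℝ) ^ 2 := by
    set ε : ℝ := 1 / ((k : ℝ) + 1) with hε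
    have hε0 : 0 < ε := by positivity
    -- Hoeffding with at most `2r` summands of coefficient at most `K r`: the exponent is at least
    -- `(ε r²)² / (K² r³)`. At `r = 0` the bound is 2, hence trivial.
    have hbound (r : ℕ) : P {ω | ε * (r : ℝ) ^ 2 ≤ |∑ i, (x r ω i - 1 / 2) * c r i|} ≤
        ENNReal.ofReal (2 * Real.exp (r * -(ε / K) ^ 2)) := by
      set A : Set (κ r → ℝ) := {y | ε * (r : ℝ) ^ 2 ≤ |∑ i, (y i - 1 / 2) * c r i|}
      have h1 : P (x r ⁻¹' A) ≤ P.map (x r) A :=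
        Measure.le_map_apply (aemeasurable_of_isUniform (hx r)) A
      refine h1.trans ?_
      rw [map_eq_pi_of_isUniform (hx r), ← ofReal_measureReal]
      refine ENNReal.ofReal_le_ofReal ?_
      rcases Nat.eq_zero_or_pos r with rfl | hr
      · refine measureReal_le_one.trans ?_
        simp
      rcases Nat.eq_zero_or_pos (Fintype.card (κ r)) with h0 | h0
      · have : IsEmpty (κ r) := Fintype.card_eq_zero_iff.1 h0
        have hA : A = ∅ := by
          refine Set.eq_empty_of_forall_notMem fun y hy => ?_
          have hy' : ε * (r : ℝ) ^ 2 ≤ |∑ i, (y i - 1 / 2) * c r i| := hy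
          rw [Finset.univ_eq_empty, Finset.sum_empty, abs_zero] at hy'
          have : 0 < ε * (r : ℝ) ^ 2 := by positivity
          linarith
        rw [hA, measureReal_empty]
        positivity
      refine (measure_le_abs_sum_sub_half_mul_le (hc r) (by positivity)).trans ?_
      gcongr
      have hrR : (1 : ℝ) ≤ r := by exact_mod_cast hr
      have hcard : (Fintype.card (κ r) : ℝ) ≤ 2 * r := by
        have : (Fintype.card (κ r) : ℝ) ≤ r + 1 := by exact_mod_cast hκ r
        linarith
      have h0R : (0 : ℝ) < Fintype.card (κ r) := by exact_mod_cast h0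
      rw [neg_div, mul_neg, neg_le_neg_iff, le_div_iff₀ (by positivity)]
      calc (r : ℝ) * (ε / K) ^ 2 * (2 * (Fintype.card (κ r) * (K * r / 2) ^ 2))
          ≤ r * (ε / K) ^ 2 * (2 * (2 * r * (K * r / 2) ^ 2)) := by gcongr
        _ = (ε * r ^ 2) ^ 2 := by field_simp
    have hsum : ∑' r : ℕ, P {ω | ε * (r : ℝ) ^ 2 ≤ |∑ i, (x r ω i - 1 / 2) * c r i|} ≠ ⊤ := by
      refine ne_top_of_le_ne_top ?_ (ENNReal.tsum_le_tsum hbound)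
      refine Summable.tsum_ofReal_ne_top (Summable.mul_left _ ?_)
      rw [Real.summable_exp_nat_mul_iff]
      have : 0 < (ε / K) ^ 2 := by positivity
      linarith
    -- First Borel–Cantelli lemma, which needs no independence between rows.
    filter_upwards [ae_eventually_notMem hsum] with ω hω
    filter_upwards [hω] with r hr
    simpa using hr
  filter_upwards [ae_all_iff.2 key] with ω hω
  rw [Metric.tendsto_atTop']
  intro δ hδ
  obtain ⟨k, hk⟩ := exists_nat_one_div_lt hδ
  obtain ⟨N, hN⟩ := eventually_atTop.1 (hω k)
  refine ⟨N, fun r hr => ?_⟩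
  have hr0 : (0 : ℝ) < r := by exact_mod_cast (Nat.zero_le _).trans_lt hr
  rw [dist_zero_right, norm_div, Real.norm_eq_abs, Real.norm_of_nonneg (by positivity),
    div_lt_iff₀ (by positivity)]
  refine (hN r hr.le).trans ?_
  gcongr

end ProbabilityTheory

/-! ### Comparison with the mean, and the normalizing function -/

theorem Finset.card_mul_le_sum_of_subset {s t : Finset ℕ} (hst : s ⊆ t) {f : ℕ → ℝ} {b : ℝ}
    (hf : ∀ i ∈ t, 0 ≤ f i) (hb : ∀ i ∈ s, b ≤ f i) : s.card * b ≤ ∑ i ∈ t, f i := by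
  rw [← nsmul_eq_mul]
  exact (Finset.card_nsmul_le_sum s f b hb).trans
    (Finset.sum_le_sum_of_subset_of_nonneg hst fun i hi _ => hf i hi)

/-- At least `r/8` indices at the top (`σ = 1`) or bottom (`σ = -1`) of the range contribute at
least `r/4` each. -/
theorem sq_div_le_sum_max {i₀ r : ℕ} (hi₀ : i₀ ≤ 1) (hr : 4 ≤ r) {σ : ℝ} (hσ : σ = 1 ∨ σ = -1) :
    (r : ℝ) ^ 2 / 32 ≤ ∑ i ∈ Finset.Icc i₀ r, max (σ * ((i : ℝ) - r / 2)) 0 := by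
  have h8 : (r : ℝ) ≤ 8 * (r / 4 : ℕ) := by exact_mod_cast (by omega : r ≤ 8 * (r / 4))
  have h4 : 4 * ((r / 4 : ℕ) : ℝ) ≤ r := by exact_mod_cast (by omega : 4 * (r / 4) ≤ r)
  have hmax : ∀ i ∈ Finset.Icc i₀ r, 0 ≤ max (σ * ((i : ℝ) - r / 2)) 0 :=
    fun i _ => le_max_right _ _
  have hr0 : (0 : ℝ) ≤ r := Nat.cast_nonneg r
  rcases hσ with rfl | rfl
  · refine le_trans ?_ (Finset.card_mul_le_sum_of_subset (s := Finset.Icc (r - r / 4) r)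
      (b := (r : ℝ) / 4) (Finset.Icc_subset_Icc (by omega) le_rfl) hmax ?_)
    · rw [Nat.card_Icc, show r + 1 - (r - r / 4) = r / 4 + 1 by omega]
      push_cast
      nlinarith
    · intro i hi
      have h : (r : ℝ) ≤ i + (r / 4 : ℕ) := by
        have := (Finset.mem_Icc.1 hi).1
        exact_mod_cast (by omega : r ≤ i + r / 4)
      refine le_max_of_le_left ?_
      linarith
  · refine le_trans ?_ (Finset.card_mul_le_sum_of_subset (s := Finset.Icc 1 (r / 4))
      (b := (r : ℝ) / 4) (Finset.Icc_subset_Icc (by omega) (by omega)) hmax ?_)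
    · rw [Nat.card_Icc, Nat.add_sub_cancel]
      nlinarith
    · intro i hi
      have h : (i : ℝ) ≤ (r / 4 : ℕ) := by exact_mod_cast (Finset.mem_Icc.1 hi).2
      refine le_max_of_le_left ?_
      linarith

theorem abs_max_mul_sub_max_mul_le {σ : ℝ} (hσ : σ = 1 ∨ σ = -1) (x y : ℝ) :
    |max (σ * x) 0 - max (σ * y) 0| ≤ |x - y| := by
  refine (abs_max_sub_max_le_abs _ _ _).trans_eq ?_
  rw [← mul_sub, abs_mul]
  rcases hσ with rfl | rfl <;> simp

theorem abs_max_mul_sub_half_le {σ : ℝ} (hσ : σ = 1 ∨ σ = -1) {i r : ℕ} (hi : i ≤ r) :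
    |max (σ * ((i : ℝ) - r / 2)) 0| ≤ r := by
  have h := abs_max_mul_sub_max_mul_le hσ ((i : ℝ) - r / 2) 0
  have h1 : (i : ℝ) ≤ r := by exact_mod_cast hi
  rw [mul_zero, max_self, sub_zero, sub_zero] at h
  exact h.trans (abs_le.2 ⟨by linarith [Nat.cast_nonneg (α := ℝ) i],
    by linarith [Nat.cast_nonneg (α := ℝ) r]⟩)

/-- The deterministic and the random part of a weighted sum of truncated linear functions, where the
truncation point moves by `o(r)`. -/
theorem tendsto_two_mul_sum_div_sum {κ : ℕ → Type*} [∀ r, Fintype (κ r)]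
    (hκ : ∀ r, Fintype.card (κ r) ≤ r + 1) {x w : (r : ℕ) → κ r → ℝ} {f g : (r : ℕ) → κ r → ℝ}
    (hx : ∀ r, x r ∈ Set.Icc (0 : κ r → ℝ) 1) (hw : ∀ r i, w r i ∈ Set.Icc (0 : ℝ) 1)
    {δ : ℕ → ℝ} (hδ0 : ∀ r, 0 ≤ δ r) (hfg : ∀ r i, |f r i - g r i| ≤ δ r)
    (hδ : Tendsto (fun r : ℕ => (r + 1) * δ r / (r : ℝ) ^ 2) atTop (𝓝 0))
    (hg : Tendsto (fun r : ℕ => (∑ i, (x r i - 1 / 2) * (w r i * g r i)) / (r : ℝ) ^ 2) atTop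
      (𝓝 0)) {c : ℝ} (hc : 0 < c)
    (hW : ∀ᶠ r : ℕ in atTop, c * (r : ℝ) ^ 2 ≤ ∑ i, w r i * g r i) :
    Tendsto (fun r : ℕ => 2 * (∑ i, x r i * (w r i * f r i)) / ∑ i, w r i * g r i) atTop
      (𝓝 1) := by
  have hfgsum (r : ℕ) : |∑ i, x r i * (w r i * (f r i - g r i))| ≤ (r + 1) * δ r := by
    refine (Finset.abs_sum_le_sum_abs _ _).trans ((Finset.sum_le_card_nsmul _ _ (δ r)
      fun i _ => ?_).trans ?_)
    · rw [abs_mul, abs_mul, abs_of_nonneg ((hx r).1 i), abs_of_nonneg (hw r i).1]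
      calc _ ≤ 1 * (1 * δ r) := by
            gcongr
            · exact mul_nonneg (hw r i).1 (abs_nonneg _)
            · exact (hx r).2 i
            · exact (hw r i).2
            · exact hfg r i
        _ = δ r := by ring
    · rw [nsmul_eq_mul, Finset.card_univ]
      refine mul_le_mul_of_nonneg_right ?_ (hδ0 r)
      exact_mod_cast hκ r
  have hlim : Tendsto (fun r : ℕ => 2 / c * (|(∑ i, (x r i - 1 / 2) * (w r i * g r i)) /
      (r : ℝ) ^ 2| + (r + 1) * δ r / (r : ℝ) ^ 2)) atTop (𝓝 0) := by
    simpa using (hg.abs.add hδ).const_mul (2 / c)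
  rw [tendsto_iff_norm_sub_tendsto_zero]
  refine squeeze_zero' (Eventually.of_forall fun _ => norm_nonneg _) ?_ hlim
  filter_upwards [hW, eventually_ge_atTop 1] with r hr hr1
  have hr0 : (0 : ℝ) < r := by positivity
  have hW0 : 0 < ∑ i, w r i * g r i := lt_of_lt_of_le (by positivity) hr
  -- The error is a centred fluctuation plus the cost of replacing `f` by `g`; both are `o(r²)`,
  -- against a denominator of at least `c r²`.
  have hsplit : 2 * (∑ i, x r i * (w r i * f r i)) - ∑ i, w r i * g r i =
      2 * (∑ i, (x r i - 1 / 2) * (w r i * g r i) +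
        ∑ i, x r i * (w r i * (f r i - g r i))) := by
    rw [← Finset.sum_add_distrib, Finset.mul_sum, Finset.mul_sum, ← Finset.sum_sub_distrib]
    exact Finset.sum_congr rfl fun i _ => by ring
  rw [div_sub_one hW0.ne', hsplit, Real.norm_eq_abs, abs_div, abs_of_pos hW0, abs_mul, abs_two,
    abs_div, abs_of_pos (by positivity : 0 < (r : ℝ) ^ 2), ← add_div, div_mul_div_comm]
  gcongr
  · have := hδ0 r
    positivity
  · exact (abs_add_le _ _).trans (add_le_add_right (hfgsum r) _)

/-- The truncation point moves by `O(√r)` in each of at most `r + 1` terms: `O(r^{3/2})` in total.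
-/
theorem tendsto_succ_mul_abs_div_sq {s : ℕ → ℕ} {a : ℝ}
    (h : Tendsto (fun r : ℕ => (2 * (s r : ℝ) - r) / √r) atTop (𝓝 a)) (b : ℝ) :
    Tendsto (fun r : ℕ => (r + 1) * |(2 * (s r : ℝ) - r + b) / 2| / (r : ℝ) ^ 2) atTop
      (𝓝 0) := by
  have h1 := (tendsto_two_mul_sub_succ_div_sqrt h b).abs
  have h2 : Tendsto (fun r : ℕ => 2 / √((r + 1 : ℕ) : ℝ)) atTop (𝓝 0) :=
    (Real.tendsto_sqrt_atTop.comp (tendsto_natCast_atTop_atTop.comp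
      (tendsto_add_atTop_nat 1))).const_div_atTop 2
  have h3 := h1.mul h2
  rw [mul_zero] at h3
  refine squeeze_zero' (Eventually.of_forall fun r => by positivity) ?_ h3
  filter_upwards [eventually_ge_atTop 1] with r hr
  have hr1 : (1 : ℝ) ≤ r := by exact_mod_cast hr
  rw [abs_div, abs_div, abs_two, abs_of_nonneg (Real.sqrt_nonneg _), div_mul_div_comm,
    Real.mul_self_sqrt (by positivity), div_le_div_iff₀ (by positivity) (by positivity)]
  push_cast
  have h4 : ((r : ℝ) + 1) ^ 2 ≤ 4 * r ^ 2 := by nlinarith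
  nlinarith [mul_le_mul_of_nonneg_left h4 (abs_nonneg (2 * (s r : ℝ) - r + b))]

/-- Covers both rows: `σ = 1`, `s₀ = 0` gives `q = 1`, and `σ = -1`, `s₀ = 1` gives `q = 2`. -/
theorem exists_normalization_tendsto_exp
    {σ : ℝ} (hσ : σ = 1 ∨ σ = -1) (s₀ : ℕ) {i₀ : ℕ} (hi₀ : i₀ ≤ 1)
    (e : (r : ℕ) → Finset.Icc i₀ r → ℕ) (he : ∀ r i, 0 < e r i)
    (C : ℝ) (hC : ∀ r i j, (e r i : ℝ) ≤ C * (e r j : ℝ)) :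
    ∃ F : ℕ → ℝ,
      ∀ (Ω : Type*) [MeasurableSpace Ω] (P : Measure Ω) [IsProbabilityMeasure P]
        (x : (r : ℕ) → Ω → Finset.Icc i₀ r → ℝ),
        (∀ r, pdf.IsUniform (x r) (Set.Icc 0 1) P volume) →
        ∀ᵐ ω ∂P, ∀ (a : ℝ) (p : ℕ → ℕ),
          Tendsto (fun r : ℕ => (2 * (p r : ℝ) - r) / Real.sqrt r) atTop (𝓝 a) →
          Tendsto (fun r : ℕ => F r * ∑ i, x r ω i * (((r + 1).choose (p r + s₀) / (r + 1)) *
            (e r i * max (σ * ((i : ℕ) - (p r + s₀ : ℕ) : ℝ)) 0))) atTop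
            (𝓝 (Real.exp (-a ^ 2 / 2))) := by
  -- Dividing by the largest multiplicity puts the weights in `[C⁻¹, 1]`.
  set E : ℕ → ℝ := fun r => (Finset.univ.sup (e r) : ℕ) with hE
  set w : (r : ℕ) → Finset.Icc i₀ r → ℝ := fun r i => e r i / E r with hw
  set g : (r : ℕ) → Finset.Icc i₀ r → ℝ := fun r i => max (σ * ((i : ℕ) - (r : ℝ) / 2)) 0 with hg
  have heE (r i) : (e r i : ℝ) ≤ E r := by
    simp only [hE, Nat.cast_le]
    exact Finset.le_sup (Finset.mem_univ i)
  have hER (r) (i : Finset.Icc i₀ r) : 0 < E r := lt_of_lt_of_le (by exact_mod_cast he r i) (heE r i)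
  have hEC (r i) : E r ≤ C * e r i := by
    obtain ⟨j, -, hj⟩ := Finset.exists_mem_eq_sup Finset.univ ⟨i, Finset.mem_univ i⟩ (e r)
    simp only [hE]
    rw [hj]
    exact hC r j i
  have hC0 : 0 < C := by
    have h1 := hC 1 ⟨1, by simp [hi₀]⟩ ⟨1, by simp [hi₀]⟩
    have h2 : (0 : ℝ) < e 1 ⟨1, by simp [hi₀]⟩ := by exact_mod_cast he _ _
    by_contra h
    nlinarith
  have hw01 (r i) : w r i ∈ Set.Icc (0 : ℝ) 1 :=
    ⟨by positivity, div_le_one_of_le₀ (heE r i) (hER r i).le⟩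
  have hwC (r i) : C⁻¹ ≤ w r i := by
    rw [hw, le_div_iff₀ (hER r i), inv_mul_le_iff₀ hC0]
    exact hEC r i
  have hcard (r : ℕ) : Fintype.card (Finset.Icc i₀ r) ≤ r + 1 := by
    rw [Fintype.card_coe, Nat.card_Icc]
    omega
  have hgr (r i) : |g r i| ≤ r := abs_max_mul_sub_half_le hσ (Finset.mem_Icc.1 i.2).2
  have hW : ∀ᶠ r : ℕ in atTop, C⁻¹ / 32 * (r : ℝ) ^ 2 ≤ ∑ i, w r i * g r i := by
    filter_upwards [eventually_ge_atTop 4] with r hr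
    calc _ = C⁻¹ * ((r : ℝ) ^ 2 / 32) := by ring
      _ ≤ C⁻¹ * ∑ i, g r i := by
          gcongr
          rw [hg, Finset.sum_coe_sort (Finset.Icc i₀ r)
            fun i : ℕ => max (σ * ((i : ℝ) - (r : ℝ) / 2)) 0]
          exact sq_div_le_sum_max hi₀ hr hσ
      _ ≤ _ := by
          rw [Finset.mul_sum]
          gcongr with i _
          exact hwC r i
  -- The local limit normalization times `r + 1`, divided by the mean `E r * (∑ i, w r i * g r i) /
  -- 2` of the sum centred at `r/2`.
  refine ⟨fun r => √(r + 1 : ℕ) / 2 ^ (r + 1) * √(Real.pi / 2) * (r + 1) *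
    (2 / (E r * ∑ i, w r i * g r i)), ?_⟩
  intro Ω _ P _ x hx
  have hlln := ProbabilityTheory.ae_tendsto_sum_sub_half_mul_div_sq hx zero_lt_one
    (c := fun r i => w r i * g r i) (fun r i => by
      rw [abs_mul, abs_of_nonneg (hw01 r i).1]
      exact mul_le_mul (hw01 r i).2 (hgr r i) (abs_nonneg _) zero_le_one) hcard
  -- Here `ω` is fixed before `a` and `p`: neither almost sure event involves them.
  filter_upwards [hlln, ae_all_iff.2 fun r => ProbabilityTheory.ae_mem_Icc_of_isUniform (hx r)]
    with ω hω hω01 a p hp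
  have hratio := tendsto_two_mul_sum_div_sum hcard hω01 hw01
    (f := fun r i => max (σ * ((i : ℕ) - (p r + s₀ : ℕ) : ℝ)) 0) (g := g)
    (δ := fun r => |(2 * (p r : ℝ) - r + 2 * s₀) / 2|) (fun _ => abs_nonneg _) (fun r i => by
      refine (abs_max_mul_sub_max_mul_le hσ _ _).trans_eq ?_
      rw [← abs_neg]
      congr 1
      push_cast
      ring) (tendsto_succ_mul_abs_div_sq hp _) hω (by positivity) hW
  have hbinom := Nat.tendsto_choose_mul_sqrt_div_two_pow (n := fun r : ℕ => r + 1)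
    (s := fun r => p r + s₀) (tendsto_add_atTop_nat 1)
    ((tendsto_two_mul_sub_succ_div_sqrt hp (2 * s₀ - 1)).congr fun r => by
      push_cast
      ring)
  have hprod := hbinom.mul hratio
  rw [mul_one] at hprod
  refine hprod.congr' ?_
  filter_upwards [eventually_ge_atTop 1, hW] with r hr hWr
  -- `r ≥ 1` ensures that the index set is nonempty even when `i₀ = 1`.
  have hE0 : E r ≠ 0 := (hER r ⟨r, by simp; omega⟩).ne'
  have hW0 : ∑ i, w r i * g r i ≠ 0 := (lt_of_lt_of_le (by positivity) hWr).ne'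
  have hsum : ∑ i, x r ω i * (((r + 1).choose (p r + s₀) / (r + 1)) *
      (e r i * max (σ * ((i : ℕ) - (p r + s₀ : ℕ) : ℝ)) 0)) =
      ((r + 1).choose (p r + s₀) / (r + 1)) * E r *
      ∑ i, x r ω i * (w r i * max (σ * ((i : ℕ) - (p r + s₀ : ℕ) : ℝ)) 0) := by
    rw [Finset.mul_sum]
    refine Finset.sum_congr rfl fun i _ => ?_
    simp only [hw]
    field_simp
  rw [hsum]
  have hr1 : (r : ℝ) + 1 ≠ 0 := by positivity
  field_simp

theorem mainTheorem8
    (q : ℤ) (hq : q = 1 ∨ q = 2)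
    (i₀ : ℕ) (hi₀ : i₀ = 0 ∨ i₀ = 1)
    (Pi : (r : ℕ) → Finset.Icc i₀ r → MinGradedResolution (r + 1))
    (hPi : ∀ r (i : Finset.Icc i₀ r), (Pi r i).HasPureShape r i)
    (e : (r : ℕ) → Finset.Icc i₀ r → ℕ)
    (he : ∀ r i, (Pi r i).IsOneDimOfMultiplicity (e r i))
    (C : ℝ) (hC : ∀ r i j, (e r i : ℝ) ≤ C * (e r j : ℝ)) :
    ∃ F : ℕ → ℝ,
      ∀ (Ω : Type*) [MeasurableSpace Ω] (P : Measure Ω) [IsProbabilityMeasure P]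
        (x : (r : ℕ) → Ω → Finset.Icc i₀ r → ℝ),
        (∀ r, pdf.IsUniform (x r) (Set.Icc 0 1) P volume) →
        ∀ᵐ ω ∂P, ∀ (a : ℝ) (p : ℕ → ℕ),
          Tendsto (fun r : ℕ => (2 * (p r : ℝ) - r) / Real.sqrt r) atTop (𝓝 a) →
          Tendsto (fun r : ℕ => F r * tableEntry (Pi r) (x r ω) (p r) q) atTop
            (𝓝 (Real.exp (-a ^ 2 / 2))) := by
  have hi₁ : i₀ ≤ 1 := by omega
  have hle (r) (i : Finset.Icc i₀ r) : (i : ℕ) ≤ r := (Finset.mem_Icc.1 i.2).2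
  rcases hq with rfl | rfl
  · obtain ⟨F, hF⟩ := exists_normalization_tendsto_exp (Or.inl rfl) 0 hi₁ e
      (fun r i => (he r i).1) C hC
    refine ⟨F, fun Ω _ P _ x hx => ?_⟩
    filter_upwards [hF Ω P x hx] with ω hω a p hp
    refine (hω a p hp).congr fun r => ?_
    rw [tableEntry]
    congr 1
    refine Finset.sum_congr rfl fun i _ => ?_
    rw [(hPi r i).betti_one (hle r i) (he r i), add_zero, one_mul]
  · obtain ⟨F, hF⟩ := exists_normalization_tendsto_exp (Or.inr rfl) 1 hi₁ e
      (fun r i => (he r i).1) C hC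
    refine ⟨F, fun Ω _ P _ x hx => ?_⟩
    filter_upwards [hF Ω P x hx] with ω hω a p hp
    refine (hω a p hp).congr fun r => ?_
    rw [tableEntry]
    congr 1
    refine Finset.sum_congr rfl fun i _ => ?_
    rw [(hPi r i).betti_two (hle r i) (he r i), neg_one_mul]
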